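/- For $k\ge 1$ let $$C_{2k}(q) = -\frac{B_{2k}}{2k\,(2k)!} + \frac{2}{(2k)!}\sum_{n\ge 1}\sum_{d\mid n} d^{2k-1} q^n$$ be the Eisenstein series ($B_{2k}$ the Bernoulli numbers), and let $\mathrm{QMod}=\mathbb{C}[C_2,C_4,C_6]\subset\mathbb{C}[[q]]$ be the ring of quasi-modular forms, graded by giving $C_{2k}$ weight $2k$; $\mathrm{QMod}_w$ denotes its weight $w$ part (so $\mathrm{QMod}_w=0$ for $w<0$). **Proposition.** Let $\sigma$ be an even integer (possibly negative), and let $$F(u,q)=\sum_{m\ge 0} f_m(q)\,u^m$$ be a formal power series in $u$ with coefficients $f_m(q)\in\mathbb{C}[[q]]$. For $n\ge 0$ write $F_n(u)=\sum_{m\ge 0}[f_m(q)]_{q^n}\,u^m$, where $[\,\cdot\,]_{q^n}$ is the coefficient of $q^n$. Assume: (a) $f_m\in \mathrm{QMod}_{m+\sigma}$ for every $m\ge 0$; (b) for every $n\ge 0$ there is a rational function $R_n(y)\in\mathbb{C}(y)$ such that $F_n(u)$ is the Laurent expansion at $u=0$ of $R_n(-e^{iu})$, and $\sum_{r\in\mathbb{Z}}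 c(n,r)\,y^r$ is a Laurent expansion of $R_n(y)$ in some non-empty annulus $a<|y|<b$, $0\le a<b$ (for instance the expansion at $y=0$ or at $y=\infty$); (c) $c(n,r)=0$ unless $r^2\le 4n+1$; (d) $f_m=0$ for all $m\le B(\sigma)$, where $$B(\sigma)=2\left\lfloor \sigma+1+\sqrt{2\sigma^2+3\sigma+4}\right\rfloor .$$ Then $F(u,q)=0$. -/

import Mathlib

noncomputable section

namespace QuasiModularSeries

/-- The `q`-series
`C_{2k}(q) = - B_{2k} / (2k (2k)!) + (2 / (2k)!) ∑_{n ≥ 1} ∑_{d ∣ n} d^{2k-1} q^n`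
(the Eisenstein series of weight `2k`; used for `k = 1, 2, 3`). -/
def eisensteinC (k : ℕ) : PowerSeries ℂ :=
  PowerSeries.mk fun n =>
    if n = 0 then -(bernoulli (2 * k) : ℂ) / ((2 * k : ℂ) * ((2 * k).factorial : ℂ))
    else 2 / ((2 * k).factorial : ℂ) * ∑ d ∈ n.divisors, (d : ℂ) ^ (2 * k - 1)

/-- The space `QMod_w` of (`q`-expansions of) quasi-modular forms of weight `w ∈ ℤ`: the values at
`(C_2, C_4, C_6)` of the polynomials over `ℂ` in three variables which are homogeneous of weight
`w` when the variables have weights `2, 4, 6`. It is zero for `w < 0`. -/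
def QMod (w : ℤ) : Submodule ℂ (PowerSeries ℂ) :=
  (MvPolynomial.weightedHomogeneousSubmodule ℂ (![2, 4, 6] : Fin 3 → ℤ) w).map
    (MvPolynomial.aeval ![eisensteinC 1, eisensteinC 2, eisensteinC 3]).toLinearMap

/-- For `F(u,q) = ∑_m f_m(q) u^m`, a power series in `u` whose coefficients are power series in
`q`, the series `F_n(u) = ∑_m [f_m(q)]_{q^n} u^m`. -/
def qCoeff (F : PowerSeries (PowerSeries ℂ)) (n : ℕ) : PowerSeries ℂ :=
  PowerSeries.mk fun m => PowerSeries.coeff n (PowerSeries.coeff m F)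

/-- The power series `-e^{iu}` in `u`. -/
def negExp : PowerSeries ℂ :=
  -PowerSeries.rescale Complex.I (PowerSeries.exp ℂ)

/-- A non-zero polynomial in `y` stays non-zero after `y = -e^{iu}`, so no denominator vanishes in
`substNegExp`. -/
theorem aeval_negExp_ne_zero (Q : Polynomial ℂ) (hQ : Q ≠ 0) :
    Polynomial.aeval negExp Q ≠ 0 := by
  have hD : PowerSeries.derivative ℂ negExp = PowerSeries.C Complex.I * negExp := by
    ext n
    have hn : (n : ℂ) + 1 ≠ 0 := by exact_mod_cast Nat.succ_ne_zero n
    have hf : (n.factorial : ℂ) ≠ 0 := by exact_mod_cast n.factorial_ne_zero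
    rw [PowerSeries.coeff_derivative]
    simp only [negExp, map_neg, PowerSeries.coeff_rescale, PowerSeries.coeff_exp, mul_neg,
      PowerSeries.coeff_C_mul, Nat.factorial_succ, pow_succ]
    push_cast
    field_simp
  have hu : negExp ≠ 0 := by
    intro h
    have := congrArg (PowerSeries.coeff 0) h
    rw [negExp, map_neg, PowerSeries.coeff_rescale, PowerSeries.coeff_exp] at this
    simp at this
  suffices H : ∀ (d : ℕ) (Q : Polynomial ℂ), Q.natDegree ≤ d → Q ≠ 0 →
      Polynomial.aeval negExp Q ≠ 0 from H _ Q le_rfl hQ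
  intro d
  induction d with
  | zero =>
    intro Q h hQ h0
    rw [Polynomial.eq_C_of_natDegree_le_zero h] at h0 hQ
    simp at h0 hQ
    exact hQ h0
  | succ d ih =>
    intro Q h hQ h0
    have h1 : Polynomial.aeval negExp (Polynomial.derivative Q) = 0 := by
      have h2 := congrArg (PowerSeries.derivative ℂ) h0
      rw [map_zero, Derivation.map_aeval, hD] at h2
      simpa [hu] using h2
    by_cases h3 : Polynomial.derivative Q = 0
    · have h5 := Polynomial.derivative_eq_zero.mp h3
      rw [Polynomial.eq_C_of_natDegree_eq_zero h5] at h0 hQ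
      simp at h0 hQ
      exact hQ h0
    · exact ih _ (by have := Polynomial.natDegree_derivative_le Q; omega) h3 h1

/-- The Laurent expansion in `u` of `R(-e^{iu})`, for a rational function `R(y)`. -/
def substNegExp (R : RatFunc ℂ) : LaurentSeries ℂ :=
  R.eval (algebraMap ℂ (LaurentSeries ℂ)) (negExp : LaurentSeries ℂ)

/-- `∑_{r ∈ ℤ} c(r) y^r` is a Laurent expansion (centred at `y = 0`) of the rational function
`R(y)`: on some non-empty annulus `a < |y| < b` the function `R` has no pole and the series
converges to it. Expansions at `y = 0` and at `y = ∞` are included. -/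
def IsLaurentExpansion (R : RatFunc ℂ) (c : ℤ → ℂ) : Prop :=
  ∃ a b : ℝ, 0 ≤ a ∧ a < b ∧ ∀ y : ℂ, a < ‖y‖ → ‖y‖ < b →
    R.denom.eval y ≠ 0 ∧ HasSum (fun r : ℤ => c r * y ^ r) (R.eval (RingHom.id ℂ) y)

/-- The bound `B(σ) = 2 ⌊σ + 1 + √(2σ² + 3σ + 4)⌋`. -/
def vanishingBound (σ : ℤ) : ℤ :=
  2 * ⌊(σ : ℝ) + 1 + Real.sqrt (2 * (σ : ℝ) ^ 2 + 3 * (σ : ℝ) + 4)⌋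

end QuasiModularSeries

end

/-! Compare the order of vanishing in `u` with the order of vanishing in `q`. If `F ≠ 0`, let `m` be
minimal with `f_m ≠ 0`, let `N` be the `q`-order of `f_m`, and write `m + σ = 2v`. Then `F_N(u)`
vanishes at `u = 0` to order exactly `m`. By (b) and (c) it is a Laurent polynomial in `y = -e^{iu}`
with exponents `|r| ≤ √(4N+1)`, so `m ≤ 2√(4N+1)` (`le_two_mul_of_X_pow_dvd`). Conversely `6N ≤
v(v+1)` (`six_mul_order_le`). Together these bound `m` quadratically, which contradicts `m > B(σ)`.

The order bound is the main work. Ramanujan's identities lift `D = q d/dq` to a derivation of the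
polynomial ring in `C₂, C₄, C₆`, where unique factorization reduces the bound to a prime `f`. If `f
∤ Df`, a Bézout-type dimension count for `f A + Df · B` gives it (`six_mul_order_le_of_coprime`). If
`f ∣ Df`, then `Df = c C₂ f`, and leading coefficients give the stronger `6ν ≤ v`
(`order_le_of_dvd`). All counting takes place among polynomials, so algebraic independence of `C₂,
C₄, C₆` is not needed. -/

namespace QuasiModularSeries

/-! ### Periodic holomorphic functions, their `q`-expansions and derivatives. -/

section RamanujanIdentities

open UpperHalfPlane hiding I
open Function Complex Derivative EisensteinSeries ModularForm Matrix.SpecialLinearGroup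
open scoped Manifold MatrixGroups ModularForm Topology Real ArithmeticFunction.sigma

local notation "𝕢" => Periodic.qParam

/-- A holomorphic function on the upper half plane which is `1`-periodic and bounded at `i∞`. -/
structure IsHolomorphicAtInfty (f : ℍ → ℂ) : Prop where
  periodic : Periodic (f ∘ ofComplex) (1 : ℝ)
  mdiff : MDiff f
  bdd : IsBoundedAtImInfty f

/-- The derivation `q d/dq` of `ℂ⟦q⟧`. -/
noncomputable def qDerivative : Derivation ℂ (PowerSeries ℂ) (PowerSeries ℂ) :=
  (PowerSeries.X : PowerSeries ℂ) • PowerSeries.derivative ℂ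

theorem coeff_qDerivative (f : PowerSeries ℂ) (n : ℕ) :
    PowerSeries.coeff n (qDerivative f) = n * PowerSeries.coeff n f := by
  rw [qDerivative, Derivation.smul_apply, smul_eq_mul]
  cases n with
  | zero => simp
  | succ n =>
    rw [PowerSeries.coeff_succ_X_mul, PowerSeries.coeff_derivative]
    push_cast
    ring

theorem qParam_one_add_one (τ : ℂ) : 𝕢 1 (τ + (1 : ℝ)) = 𝕢 1 τ := by
  simp only [Periodic.qParam, ofReal_one, div_one, mul_add, mul_one, Complex.exp_add,
    Complex.exp_two_pi_mul_I]

namespace IsHolomorphicAtInfty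

variable {f g : ℍ → ℂ}

theorem analyticAt (hf : IsHolomorphicAtInfty f) : AnalyticAt ℂ (cuspFunction 1 f) 0 :=
  analyticAt_cuspFunction_zero one_pos hf.periodic hf.mdiff hf.bdd

theorem hasSum (hf : IsHolomorphicAtInfty f) (τ : ℍ) :
    HasSum (fun m : ℕ ↦ (qExpansion 1 f).coeff m • 𝕢 1 τ ^ m) (f τ) :=
  hasSum_qExpansion one_pos hf.periodic hf.mdiff hf.bdd τ

theorem of_hasSum {c : ℕ → ℂ} (hf : MDiff f)
    (h : ∀ τ : ℍ, HasSum (fun m ↦ c m • 𝕢 1 τ ^ m) (f τ)) : IsHolomorphicAtInfty f where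
  periodic := by
    intro w
    by_cases! hw : 0 < im w
    · have hw' : 0 < im (w + (1 : ℝ)) := by simpa using hw
      simp only [comp_apply, ofComplex_apply_of_im_pos hw', ofComplex_apply_of_im_pos hw]
      refine (h _).unique ?_
      have := h ⟨w, hw⟩
      simp only at this ⊢
      rwa [qParam_one_add_one]
    -- Outside the half plane `ofComplex` takes one constant default value.
    · have : im (w + (1 : ℝ)) ≤ 0 := by simpa using hw
      simp only [comp_apply]
      rw [ofComplex_apply_of_im_nonpos this, ofComplex_apply_of_im_nonpos hw]
  mdiff := hf
  bdd := isBoundedAtImInfty_of_hasSum_qExpansion one_pos h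

theorem qExpansion_eq {c : ℕ → ℂ} (hf : IsHolomorphicAtInfty f)
    (h : ∀ τ : ℍ, HasSum (fun m ↦ c m • 𝕢 1 τ ^ m) (f τ)) :
    qExpansion 1 f = PowerSeries.mk c := by
  ext m
  have h1 := (hasFPowerSeriesOnBall_cuspFunction one_pos hf.analyticAt h).hasFPowerSeriesAt
  have h2 := (hasFPowerSeriesOnBall_cuspFunction one_pos hf.analyticAt hf.hasSum).hasFPowerSeriesAt
  simpa [FormalMultilinearSeries.coeff_ofScalars] using
    congr_arg (FormalMultilinearSeries.coeff · m) (h2.eq_formalMultilinearSeries h1)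

theorem of_modularForm {k : ℤ} (f : ModularForm 𝒮ℒ k) : IsHolomorphicAtInfty f where
  periodic := SlashInvariantFormClass.periodic_comp_ofComplex f one_mem_strictPeriods_SL
  mdiff := ModularFormClass.holo f
  bdd := ModularFormClass.bdd_at_infty f

theorem add (hf : IsHolomorphicAtInfty f) (hg : IsHolomorphicAtInfty g) :
    IsHolomorphicAtInfty (f + g) where
  periodic w := congrArg₂ (· + ·) (hf.periodic w) (hg.periodic w)
  mdiff := hf.mdiff.add hg.mdiff
  bdd := Filter.BoundedAtFilter.add hf.bdd hg.bdd

theorem mul (hf : IsHolomorphicAtInfty f) (hg : IsHolomorphicAtInfty g) :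
    IsHolomorphicAtInfty (f * g) where
  periodic w := congrArg₂ (· * ·) (hf.periodic w) (hg.periodic w)
  mdiff := hf.mdiff.mul hg.mdiff
  bdd := Filter.BoundedAtFilter.mul hf.bdd hg.bdd

theorem smul (a : ℂ) (hf : IsHolomorphicAtInfty f) : IsHolomorphicAtInfty (a • f) where
  periodic w := congrArg (a * ·) (hf.periodic w)
  mdiff := hf.mdiff.const_smul a
  bdd := Filter.BoundedAtFilter.smul a hf.bdd

/-- With `f = h(q)`, the chain rule turns `(2πi)⁻¹ d/dτ` into `q h'(q)`; the Taylor series of `h'`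
on the unit disc gives the coefficients. -/
theorem hasSum_deriv (hf : IsHolomorphicAtInfty f) (τ : ℍ) :
    HasSum (fun m : ℕ ↦ (qDerivative (qExpansion 1 f)).coeff m • 𝕢 1 τ ^ m)
      (normalizedDerivOfComplex f τ) := by
  set h := cuspFunction 1 f with hh
  have hd : DifferentiableOn ℂ h (Metric.ball 0 1) :=
    differentiableOn_cuspFunction_ball one_pos hf.periodic hf.mdiff hf.bdd
  have hq : ‖𝕢 1 (τ : ℂ)‖ < 1 := Periodic.norm_qParam_lt_one one_pos τ.im_pos
  have hqm : 𝕢 1 (τ : ℂ) ∈ Metric.ball (0 : ℂ) 1 := by simpa using hq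
  have hval : normalizedDerivOfComplex f τ = 𝕢 1 (τ : ℂ) * deriv h (𝕢 1 (τ : ℂ)) := by
    have hE : (f ∘ ofComplex) =ᶠ[𝓝 (τ : ℂ)] fun w ↦ h (𝕢 1 w) := by
      filter_upwards [isOpen_upperHalfPlaneSet.mem_nhds τ.im_pos] with w hw
      have := eq_cuspFunction (f := f) ⟨w, hw⟩ one_ne_zero hf.periodic
      simp only [comp_apply, ofComplex_apply_of_im_pos hw]
      exact this.symm
    have h1 : HasDerivAt h (deriv h (𝕢 1 (τ : ℂ))) (𝕢 1 (τ : ℂ)) :=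
      (hd.differentiableAt (Metric.isOpen_ball.mem_nhds hqm)).hasDerivAt
    have h2 : HasDerivAt (fun w : ℂ ↦ 𝕢 1 w) (𝕢 1 (τ : ℂ) * (2 * π * I)) (τ : ℂ) := by
      have h3 : HasDerivAt (fun w : ℂ ↦ 2 * π * I * w) (2 * π * I) (τ : ℂ) := by
        simpa using (hasDerivAt_id (τ : ℂ)).const_mul (2 * π * I)
      simpa [Periodic.qParam] using h3.cexp
    rw [normalizedDerivOfComplex, hE.deriv_eq, show deriv (fun w ↦ h (𝕢 1 w)) (τ : ℂ) = _ from
      (h1.comp (τ : ℂ) h2).deriv]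
    have : (2 * π * I : ℂ) ≠ 0 := Complex.two_pi_I_ne_zero
    field_simp
  have hs := Complex.hasSum_taylorSeries_on_ball (hd.deriv Metric.isOpen_ball) hqm
  rw [hval, ← hasSum_nat_add_iff' 1]
  simp only [coeff_qDerivative, Finset.range_one, Finset.sum_singleton, Nat.cast_zero, zero_mul,
    zero_smul, sub_zero]
  refine (hs.mul_left (𝕢 1 (τ : ℂ))).congr_fun fun m ↦ ?_
  rw [qExpansion_coeff, ← iteratedDeriv_succ', Nat.factorial_succ]
  have : ((m : ℂ) + 1) ≠ 0 := by exact_mod_cast m.succ_ne_zero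
  have : (m.factorial : ℂ) ≠ 0 := by exact_mod_cast m.factorial_ne_zero
  simp only [smul_eq_mul]
  push_cast
  field_simp
  ring

theorem deriv (hf : IsHolomorphicAtInfty f) :
    IsHolomorphicAtInfty (normalizedDerivOfComplex f) :=
  of_hasSum (normalizedDerivOfComplex_mdifferentiable hf.mdiff) hf.hasSum_deriv

theorem qExpansion_deriv (hf : IsHolomorphicAtInfty f) :
    qExpansion 1 (normalizedDerivOfComplex f) = qDerivative (qExpansion 1 f) := by
  rw [hf.deriv.qExpansion_eq hf.hasSum_deriv]
  ext; simp

/-- A function which is invariant under the slash action of weight `k` is a modular form. -/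
noncomputable def toModularForm (hf : IsHolomorphicAtInfty f) (k : ℤ)
    (hk : ∀ γ : SL(2, ℤ), f ∣[k] γ = f) : ModularForm 𝒮ℒ k where
  toFun := f
  slash_action_eq' := fun _ ⟨γ, hγ⟩ ↦ hγ ▸ hk γ
  holo' := hf.mdiff
  bdd_at_cusps' {c} hc := by
    rw [Subgroup.IsArithmetic.isCusp_iff_isCusp_SL2Z] at hc
    rw [OnePoint.isBoundedAt_iff_forall_SL2Z hc]
    intro γ _
    rw [hk γ]
    exact hf.bdd

end IsHolomorphicAtInfty

theorem isHolomorphicAtInfty_E2 : IsHolomorphicAtInfty E2 :=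
  .of_hasSum E2_mdifferentiable fun τ ↦ by
    simpa only [Function.Periodic.qParam, ofReal_one, div_one] using hasSum_qExpansion_E2 (z := τ)

/-- A level one modular form of weight less than `12` is determined by its constant term. -/
theorem qExpansion_eq_smul_of_weight_lt {k : ℕ} (hk : k < 12) (f g : ModularForm 𝒮ℒ (k : ℤ))
    {a : ℂ} (h : (qExpansion 1 f).coeff 0 = a * (qExpansion 1 g).coeff 0) :
    qExpansion 1 f = a • qExpansion 1 g := by
  have h1 : qExpansion 1 (f - a • g : ModularForm 𝒮ℒ (k : ℤ)) =
      qExpansion 1 f - a • qExpansion 1 g := by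
    have h2 := ModularForm.qExpansion_smul one_pos one_mem_strictPeriods_SL a g
    have h3 := ModularForm.qExpansion_sub one_pos one_mem_strictPeriods_SL f (a • g)
    exact h3.trans (congrArg _ h2)
  -- In weight below 12 the Sturm bound `⌊k/12⌋` is 0, so a vanishing constant term suffices.
  have h0 : (f - a • g : ModularForm 𝒮ℒ (k : ℤ)) = 0 := by
    apply sturm_bound_levelOne_nat
    rw [Nat.div_eq_of_lt hk, Nat.cast_zero, h1, pos_iff_ne_zero,
      PowerSeries.order_ne_zero_iff_constCoeff_eq_zero,
      ← PowerSeries.coeff_zero_eq_constantCoeff_apply]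
    rw [map_sub, PowerSeries.coeff_smul, h, smul_eq_mul, sub_self]
  rw [h0] at h1
  have h4 : qExpansion 1 (0 : ModularForm 𝒮ℒ (k : ℤ)) = 0 := qExpansion_zero 1
  rw [h4] at h1
  exact (sub_eq_zero.mp h1.symm)

end RamanujanIdentities

/-! ### Ramanujan's differential equations. -/

section RamanujanIdentities

open UpperHalfPlane hiding I
open Function Complex Derivative EisensteinSeries ModularForm Matrix.SpecialLinearGroup
open scoped Manifold MatrixGroups ModularForm Topology Real ArithmeticFunction.sigma

theorem mdifferentiable_D2 (γ : SL(2, ℤ)) : MDiff (D2 γ) := by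
  have h := (mdifferentiable_inv_denom (γ : GL (Fin 2) ℝ)).const_smul (2 * π * I * γ 1 0)
  have hE : D2 γ = (2 * π * I * γ 1 0 : ℂ) • fun τ : ℍ ↦ (denom (γ : GL (Fin 2) ℝ) τ)⁻¹ := by
    ext z
    simp [D2, div_eq_mul_inv]
  rw [hE]
  exact h

theorem normalizedDerivOfComplex_D2 (γ : SL(2, ℤ)) (z : ℍ) :
    normalizedDerivOfComplex (D2 γ) z = -((γ 1 0 : ℂ) / denom γ z) ^ 2 := by
  have h := (hasDerivAt_denom_zpow (γ : GL (Fin 2) ℝ) (-1) z).const_mul (2 * π * I * γ 1 0)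
  have hE : (D2 γ ∘ ofComplex) =ᶠ[𝓝 (z : ℂ)]
      fun w ↦ (2 * π * I * γ 1 0) * denom (γ : GL (Fin 2) ℝ) w ^ (-1 : ℤ) := by
    filter_upwards [isOpen_upperHalfPlaneSet.mem_nhds z.im_pos] with w hw
    simp [D2, ofComplex_apply_of_im_pos hw, div_eq_mul_inv]
  have hd := denom_ne_zero (γ : GL (Fin 2) ℝ) z
  rw [normalizedDerivOfComplex, hE.deriv_eq, h.deriv]
  have : (2 * π * I : ℂ) ≠ 0 := Complex.two_pi_I_ne_zero
  have hc : (((γ : GL (Fin 2) ℝ) 1 0 : ℝ) : ℂ) = (γ 1 0 : ℂ) := by simp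
  rw [hc, show (-1 - 1 : ℤ) = -2 by norm_num, zpow_neg, zpow_two]
  push_cast
  field_simp

/-- The anomaly `D2 γ` of `E2` enters both the derivative and the square; the factor `-1/12` makes
the contributions cancel. -/
theorem weight_four_slash_invariant (γ : SL(2, ℤ)) :
    (normalizedDerivOfComplex E2 + (-1 / 12 : ℂ) • (E2 * E2)) ∣[(4 : ℤ)] γ =
      normalizedDerivOfComplex E2 + (-1 / 12 : ℂ) • (E2 * E2) := by
  have h1 := normalizedDerivOfComplex_SL_slash (k := 2) (γ := γ) E2_mdifferentiable
  have h2 : normalizedDerivOfComplex (E2 ∣[(2 : ℤ)] γ) = normalizedDerivOfComplex E2 -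
      (1 / (2 * riemannZeta 2)) • normalizedDerivOfComplex (D2 γ) := by
    rw [E2_slash_action, normalizedDerivOfComplex_sub _ _ E2_mdifferentiable
      ((mdifferentiable_D2 γ).const_smul _), normalizedDerivOfComplex_smul _ _ (mdifferentiable_D2 γ)]
  have h3 := mul_slash_SL2 2 2 γ E2 E2
  have hE := E2_slash_action γ
  rw [SlashAction.add_slash, SL_smul_slash]
  ext z
  have h1z := congrFun h1 z
  have h2z := congrFun h2 z
  have h3z := congrFun h3 z
  have hEz := congrFun hE z
  have hDz := normalizedDerivOfComplex_D2 γ z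
  norm_num at h3z h1z
  simp only [Pi.add_apply, Pi.smul_apply, Pi.sub_apply, Pi.mul_apply, smul_eq_mul] at *
  have hd := denom_ne_zero (γ : GL (Fin 2) ℝ) z
  have hπ : (π : ℂ) ≠ 0 := by exact_mod_cast Real.pi_ne_zero
  rw [h3z]
  rw [h2z] at h1z
  have h4 := eq_sub_of_add_eq h1z.symm
  rw [h4, hEz, hDz, D2, riemannZeta_two]
  have hI : I ^ 2 = -1 := I_sq
  field_simp
  ring_nf
  simp only [hI]
  ring

theorem bernoulli_four : bernoulli 4 = -1 / 30 := by
  rw [bernoulli_eq_bernoulli'_of_ne_one (by norm_num), bernoulli'_four]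

theorem bernoulli_six : bernoulli 6 = 1 / 42 := by
  have h5 : bernoulli' 5 = 0 := bernoulli'_eq_zero_of_odd (by decide) (by norm_num)
  rw [bernoulli_eq_bernoulli'_of_ne_one (by norm_num), bernoulli'_def]
  norm_num [Finset.sum_range_succ, bernoulli'_zero, bernoulli'_one, bernoulli'_two,
    bernoulli'_three, bernoulli'_four, h5, Nat.choose]

theorem coeff_eisensteinC_zero (k : ℕ) : PowerSeries.coeff 0 (eisensteinC k) =
    -(bernoulli (2 * k) : ℂ) / ((2 * k : ℂ) * ((2 * k).factorial : ℂ)) := by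
  simp [eisensteinC]

theorem coeff_zero_eisensteinC_one : PowerSeries.coeff 0 (eisensteinC 1) = -1 / 24 := by
  rw [coeff_eisensteinC_zero, mul_one, bernoulli_two]
  norm_num [Nat.factorial]

theorem coeff_zero_eisensteinC_two : PowerSeries.coeff 0 (eisensteinC 2) = 1 / 2880 := by
  rw [coeff_eisensteinC_zero, show 2 * 2 = 4 from rfl, bernoulli_four]
  norm_num [Nat.factorial]

theorem coeff_zero_eisensteinC_three : PowerSeries.coeff 0 (eisensteinC 3) = -1 / 181440 := by
  rw [coeff_eisensteinC_zero, show 2 * 3 = 6 from rfl, bernoulli_six]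
  norm_num [Nat.factorial]

theorem coeff_eisensteinC_of_ne_zero (k : ℕ) {n : ℕ} (hn : n ≠ 0) :
    PowerSeries.coeff n (eisensteinC k) =
      2 / ((2 * k).factorial : ℂ) * ((σ (2 * k - 1) n : ℕ) : ℂ) := by
  simp [eisensteinC, hn, ArithmeticFunction.sigma_apply]

theorem qExpansion_E2 : qExpansion 1 E2 = (-24 : ℂ) • eisensteinC 1 := by
  rw [isHolomorphicAtInfty_E2.qExpansion_eq (fun τ ↦ by
    simpa only [Function.Periodic.qParam, ofReal_one, div_one] using hasSum_qExpansion_E2 (z := τ))]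
  ext n
  rw [PowerSeries.coeff_mk, PowerSeries.coeff_smul]
  rcases eq_or_ne n 0 with rfl | hn
  · rw [coeff_zero_eisensteinC_one]
    norm_num
  · rw [coeff_eisensteinC_of_ne_zero _ hn]
    simp [hn, Nat.factorial]

theorem qExpansion_E₄ : qExpansion 1 E₄ = (2880 : ℂ) • eisensteinC 2 := by
  ext n
  rw [E_qExpansion_coeff _ (by decide), PowerSeries.coeff_smul]
  rcases eq_or_ne n 0 with rfl | hn
  · rw [coeff_zero_eisensteinC_two]
    norm_num
  · rw [coeff_eisensteinC_of_ne_zero _ hn]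
    simp only [hn, ↓reduceIte, bernoulli_four, Nat.factorial, smul_eq_mul]
    norm_num
    ring

theorem qExpansion_E₆ : qExpansion 1 E₆ = (-181440 : ℂ) • eisensteinC 3 := by
  ext n
  rw [E_qExpansion_coeff _ (by decide), PowerSeries.coeff_smul]
  rcases eq_or_ne n 0 with rfl | hn
  · rw [coeff_zero_eisensteinC_three]
    norm_num
  · rw [coeff_eisensteinC_of_ne_zero _ hn]
    simp only [hn, ↓reduceIte, bernoulli_six, Nat.factorial, smul_eq_mul]
    norm_num
    ring

theorem coeff_zero_mul (f g : PowerSeries ℂ) : PowerSeries.coeff 0 (f * g) =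
    PowerSeries.coeff 0 f * PowerSeries.coeff 0 g := by
  simp

/-- The `q`-expansion of `D f + a E₂ g`. -/
theorem qExpansion_deriv_add_smul_mul {f g h : ℍ → ℂ} (hf : IsHolomorphicAtInfty f)
    (hg : IsHolomorphicAtInfty g) (hh : IsHolomorphicAtInfty h) (a : ℂ) :
    qExpansion 1 (normalizedDerivOfComplex f + a • (g * h)) =
      qDerivative (qExpansion 1 f) + a • (qExpansion 1 g * qExpansion 1 h) := by
  rw [qExpansion_add hf.deriv.analyticAt ((hg.mul hh).smul a).analyticAt,
    qExpansion_smul (hg.mul hh).analyticAt, qExpansion_mul hg.analyticAt hh.analyticAt,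
    hf.qExpansion_deriv]

theorem qDerivative_eisensteinC_one : qDerivative (eisensteinC 1) =
    (-2 : ℂ) • (eisensteinC 1 * eisensteinC 1) + (10 : ℂ) • eisensteinC 2 := by
  have h2 := isHolomorphicAtInfty_E2
  have hq := qExpansion_deriv_add_smul_mul h2 h2 h2 (-1 / 12)
  have key := qExpansion_eq_smul_of_weight_lt (k := 4) (by norm_num)
    ((h2.deriv.add ((h2.mul h2).smul (-1 / 12))).toModularForm 4 weight_four_slash_invariant) E₄
    -- `D` kills constant terms, so the constant term of `D E₂ - E₂²/12` is `-1/12`.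
    (a := -1 / 12) (by
      change PowerSeries.coeff 0 (qExpansion 1 (_ + _)) = _
      rw [hq, qExpansion_E₄, qExpansion_E2]
      simp only [map_add, PowerSeries.coeff_smul, coeff_qDerivative, coeff_zero_mul,
        coeff_zero_eisensteinC_one, coeff_zero_eisensteinC_two]
      norm_num)
  change qExpansion 1 (_ + _) = _ at key
  rw [hq, qExpansion_E₄, qExpansion_E2, Derivation.map_smul, smul_mul_smul_comm] at key
  have := congrArg ((-1 / 24 : ℂ) • ·) key
  simp only [smul_add, smul_smul] at this
  norm_num at this
  rw [← sub_eq_zero] at this ⊢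
  rw [← this]
  module

theorem slash_deriv_add_smul_mul {k : ℤ} (f : ModularForm 𝒮ℒ k) (γ : SL(2, ℤ)) :
    (normalizedDerivOfComplex f + (-(k : ℂ) / 12) • (E2 * f)) ∣[k + 2] γ =
      normalizedDerivOfComplex f + (-(k : ℂ) / 12) • (E2 * f) := by
  have h := serreDerivative_slash_invariant (γ := γ) (ModularFormClass.holo f)
    (SlashInvariantForm.slash_action_eqn f _ ⟨γ, rfl⟩)
  have hS : serreDerivative k f = normalizedDerivOfComplex f + (-(k : ℂ) / 12) • (E2 * f) := by
    ext z
    simp only [serreDerivative_apply, Pi.add_apply, Pi.smul_apply, Pi.mul_apply, smul_eq_mul]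
    ring
  rwa [hS] at h

theorem qDerivative_eisensteinC_two : qDerivative (eisensteinC 2) =
    (-8 : ℂ) • (eisensteinC 1 * eisensteinC 2) + (21 : ℂ) • eisensteinC 3 := by
  have h2 := isHolomorphicAtInfty_E2
  have h4 := IsHolomorphicAtInfty.of_modularForm E₄
  have hq := qExpansion_deriv_add_smul_mul h4 h2 h4 (-((4 : ℤ) : ℂ) / 12)
  have key := qExpansion_eq_smul_of_weight_lt (k := 6) (by norm_num)
    ((h4.deriv.add ((h2.mul h4).smul (-((4 : ℤ) : ℂ) / 12))).toModularForm 6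
      (slash_deriv_add_smul_mul E₄)) E₆
    (a := -1 / 3) (by
      change PowerSeries.coeff 0 (qExpansion 1 (_ + _)) = _
      rw [hq, qExpansion_E₄, qExpansion_E2, qExpansion_E₆]
      simp only [map_add, PowerSeries.coeff_smul, coeff_qDerivative, coeff_zero_mul,
        coeff_zero_eisensteinC_one, coeff_zero_eisensteinC_two, coeff_zero_eisensteinC_three]
      norm_num)
  change qExpansion 1 (_ + _) = _ at key
  rw [hq, qExpansion_E₄, qExpansion_E2, qExpansion_E₆, Derivation.map_smul,
    smul_mul_smul_comm] at key
  have := congrArg ((1 / 2880 : ℂ) • ·) key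
  simp only [smul_add, smul_smul] at this
  norm_num at this
  rw [← sub_eq_zero] at this ⊢
  rw [← this]
  module

theorem qDerivative_eisensteinC_three : qDerivative (eisensteinC 3) =
    (-12 : ℂ) • (eisensteinC 1 * eisensteinC 3) +
      (160 / 7 : ℂ) • (eisensteinC 2 * eisensteinC 2) := by
  have h2 := isHolomorphicAtInfty_E2
  have h6 := IsHolomorphicAtInfty.of_modularForm E₆
  have hE : qExpansion 1 (E₄.mul E₄) = qExpansion 1 E₄ * qExpansion 1 E₄ :=
    ModularForm.qExpansion_mul one_pos one_mem_strictPeriods_SL E₄ E₄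
  have hq := qExpansion_deriv_add_smul_mul h6 h2 h6 (-((6 : ℤ) : ℂ) / 12)
  have key := qExpansion_eq_smul_of_weight_lt (k := 8) (by norm_num)
    ((h6.deriv.add ((h2.mul h6).smul (-((6 : ℤ) : ℂ) / 12))).toModularForm 8
      (slash_deriv_add_smul_mul E₆)) (E₄.mul E₄)
    (a := -1 / 2) (by
      change PowerSeries.coeff 0 (qExpansion 1 (_ + _)) = _ * PowerSeries.coeff 0 (qExpansion 1
        (E₄.mul E₄))
      rw [hq, hE, qExpansion_E₄, qExpansion_E2, qExpansion_E₆]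
      simp only [map_add, PowerSeries.coeff_smul, coeff_qDerivative, coeff_zero_mul,
        coeff_zero_eisensteinC_one, coeff_zero_eisensteinC_two, coeff_zero_eisensteinC_three]
      norm_num)
  change qExpansion 1 (_ + _) = _ • qExpansion 1 (E₄.mul E₄) at key
  rw [hq, hE, qExpansion_E₄, qExpansion_E2, qExpansion_E₆, Derivation.map_smul,
    smul_mul_smul_comm, smul_mul_smul_comm] at key
  have := congrArg ((-1 / 181440 : ℂ) • ·) key
  simp only [smul_add, smul_smul] at this
  norm_num at this
  rw [← sub_eq_zero] at this ⊢
  rw [← this]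
  module

end RamanujanIdentities

/-! ### Dimensions of the weighted homogeneous pieces. -/

section Dimension

open MvPolynomial

/-- The weights of `C₂, C₄, C₆`, halved. -/
abbrev halfWeight : Fin 3 → ℕ := ![1, 2, 3]

theorem weight_halfWeight (d : Fin 3 →₀ ℕ) :
    Finsupp.weight halfWeight d = d 0 + 2 * d 1 + 3 * d 2 := by
  rw [Finsupp.weight_apply, Finsupp.sum_fintype _ _ (by simp), Fin.sum_univ_three]
  simp [mul_comm]

/-- The number of monomials in `C₂, C₄, C₆` of weight `2n`. -/
def numMonomials (n : ℕ) : ℕ := ∑ c ∈ Finset.range (n / 3 + 1), ((n - 3 * c) / 2 + 1)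

/-- Monomials divisible by `C₆²` correspond to those of weight lower by 6; the exponents 0 and 1 of
`C₆` contribute `n + 6`. -/
theorem numMonomials_add_six (n : ℕ) : numMonomials (n + 6) = numMonomials n + n + 6 := by
  rw [numMonomials, show (n + 6) / 3 + 1 = n / 3 + 1 + 1 + 1 by omega, Finset.sum_range_succ',
    Finset.sum_range_succ', numMonomials]
  have : ∀ c ∈ Finset.range (n / 3 + 1),
      (n + 6 - 3 * (c + 1 + 1)) / 2 + 1 = (n - 3 * c) / 2 + 1 := fun c _ ↦ by omega
  rw [Finset.sum_congr rfl this]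
  omega

/-- The count is a quadratic quasi-polynomial of period 6; summing over a period removes the
oscillation. -/
theorem sum_numMonomials (n : ℕ) :
    2 * ∑ i ∈ Finset.range 6, numMonomials (n + i) = (n + 5) * (n + 6) + 2 := by
  induction n with
  | zero => decide
  | succ n ih =>
    simp only [Finset.sum_range_succ, Finset.sum_range_zero] at ih ⊢
    have h := numMonomials_add_six n
    rw [show n + 1 + 5 = n + 6 by ring, h, show n + 1 + 0 = n + 1 by ring,
      show n + 1 + 1 = n + 2 by ring, show n + 1 + 2 = n + 3 by ring,
      show n + 1 + 3 = n + 4 by ring, show n + 1 + 4 = n + 5 by ring]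
    rw [add_zero] at ih
    linarith

/-- The monomials of weight `n` as pairs of exponents. -/
noncomputable def monomialsEquiv (n : ℕ) : {d : Fin 3 →₀ ℕ | Finsupp.weight halfWeight d = n} ≃
    (Finset.range (n / 3 + 1)).sigma fun c ↦ Finset.range ((n - 3 * c) / 2 + 1) where
  toFun d := ⟨⟨d.1 2, d.1 1⟩, by
    have := d.2
    simp only [Set.mem_ofPred_eq, weight_halfWeight] at this
    simp only [Finset.mem_sigma, Finset.mem_range]
    omega⟩
  invFun x := ⟨Finsupp.equivFunOnFinite.symm ![n - 2 * x.1.2 - 3 * x.1.1, x.1.2, x.1.1], by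
    have := x.2
    simp only [Finset.mem_sigma, Finset.mem_range] at this
    simp only [Set.mem_ofPred_eq, weight_halfWeight, Finsupp.equivFunOnFinite_symm_apply_apply]
    simp
    omega⟩
  left_inv d := by
    have := d.2
    simp only [Set.mem_ofPred_eq, weight_halfWeight] at this
    ext i
    fin_cases i <;> simp
    omega
  right_inv x := by simp

/-- The space of polynomials in `C₂, C₄, C₆` which are homogeneous of weight `2n`. -/
abbrev homPoly (n : ℕ) : Submodule ℂ (MvPolynomial (Fin 3) ℂ) :=
  weightedHomogeneousSubmodule ℂ halfWeight n

instance (n : ℕ) : Module.Finite ℂ (homPoly n) :=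
  Module.Finite.iff_fg.mpr (weightedHomogeneousSubmodule_fg ℂ halfWeight (by decide) n)

theorem finrank_homPoly (n : ℕ) : Module.finrank ℂ (homPoly n) = numMonomials n := by
  have : Finite {d : Fin 3 →₀ ℕ | Finsupp.weight halfWeight d = n} :=
    Finite.of_equiv _ (monomialsEquiv n).symm
  have e := basisRestrictSupport ℂ {d : Fin 3 →₀ ℕ | Finsupp.weight halfWeight d = n}
  rw [homPoly, weightedHomogeneousSubmodule_eq_finsupp_supported]
  refine (Module.finrank_eq_nat_card_basis e).trans ?_
  rw [Nat.card_congr (monomialsEquiv n), Nat.card_eq_fintype_card, Fintype.card_coe,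
    Finset.card_sigma, numMonomials]
  simp

end Dimension

/-! ### Homogeneity of factors. -/

section HomogeneousFactors

open MvPolynomial

variable {ι : Type*} (w : ι → ℕ)

/-- The algebra map `Xᵢ ↦ Xᵢ T ^ wᵢ`, which separates the weighted homogeneous components. -/
noncomputable def weightMap : MvPolynomial ι ℂ →ₐ[ℂ] Polynomial (MvPolynomial ι ℂ) :=
  aeval fun i ↦ Polynomial.C (X i) * Polynomial.X ^ w i

theorem weightMap_monomial (d : ι →₀ ℕ) (r : ℂ) :
    weightMap w (monomial d r) = Polynomial.monomial (Finsupp.weight w d) (monomial d r) := by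
  rw [weightMap, aeval_monomial, Finsupp.prod]
  simp only [mul_pow, Finset.prod_mul_distrib, ← Polynomial.C_pow, ← pow_mul]
  rw [← map_prod, Finset.prod_pow_eq_pow_sum, IsScalarTower.algebraMap_apply ℂ (MvPolynomial ι ℂ),
    Polynomial.algebraMap_eq, ← mul_assoc, ← map_mul, Polynomial.C_mul_X_pow_eq_monomial,
    Finsupp.weight_apply, Finsupp.sum, algebraMap_eq]
  congr 1
  · simp [mul_comm]
  · rw [monomial_eq]; rfl

theorem coeff_weightMap (f : MvPolynomial ι ℂ) (n : ℕ) :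
    (weightMap w f).coeff n = weightedHomogeneousComponent w n f := by
  induction f using MvPolynomial.induction_on' with
  | monomial d r =>
    rw [weightMap_monomial, Polynomial.coeff_monomial]
    split_ifs with h
    · exact ((isWeightedHomogeneous_monomial w d r h).weightedHomogeneousComponent_same).symm
    · exact ((isWeightedHomogeneous_monomial w d r rfl).weightedHomogeneousComponent_ne _ (Ne.symm h)).symm
  | add p q hp hq => rw [map_add, Polynomial.coeff_add, hp, hq, map_add]

theorem weightMap_eq_monomial {f : MvPolynomial ι ℂ} {n : ℕ} (hf : IsWeightedHomogeneous w f n) :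
    weightMap w f = Polynomial.monomial n f := by
  ext1 k
  rw [coeff_weightMap, Polynomial.coeff_monomial]
  split_ifs with h
  · exact h ▸ hf.weightedHomogeneousComponent_same
  · exact hf.weightedHomogeneousComponent_ne _ (Ne.symm h)

theorem isWeightedHomogeneous_of_weightMap {f : MvPolynomial ι ℂ} {n : ℕ}
    (h : ∀ k ≠ n, (weightMap w f).coeff k = 0) : IsWeightedHomogeneous w f n := by
  classical
  intro d hd
  by_contra hn
  apply hd
  have := congrArg (coeff d) (h _ hn)
  rwa [coeff_weightMap, coeff_weightedHomogeneousComponent, if_pos rfl, coeff_zero] at this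

/-- Factors of weighted homogeneous polynomials are weighted homogeneous. -/
theorem isWeightedHomogeneous_of_mul {f g : MvPolynomial ι ℂ} {n : ℕ} (hfg : f * g ≠ 0)
    (h : IsWeightedHomogeneous w (f * g) n) :
    ∃ a b, a + b = n ∧ IsWeightedHomogeneous w f a ∧ IsWeightedHomogeneous w g b := by
  have hm := weightMap_eq_monomial w h
  rw [map_mul] at hm
  have hne : weightMap w f * weightMap w g ≠ 0 := by
    rw [hm]
    simpa using hfg
  -- Degree and trailing degree in `T` both add over the product. They agree for the product, hence
  -- for each factor.
  have hd := congrArg Polynomial.natDegree hm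
  have ht := congrArg Polynomial.natTrailingDegree hm
  have hf0 := left_ne_zero_of_mul hne
  have hg0 := right_ne_zero_of_mul hne
  rw [Polynomial.natDegree_mul hf0 hg0, Polynomial.natDegree_monomial_eq n hfg] at hd
  rw [Polynomial.natTrailingDegree_mul hf0 hg0, Polynomial.natTrailingDegree_monomial hfg] at ht
  have h1 := Polynomial.natTrailingDegree_le_natDegree (weightMap w f)
  have h2 := Polynomial.natTrailingDegree_le_natDegree (weightMap w g)
  refine ⟨_, _, hd, ?_, ?_⟩ <;>
  · refine isWeightedHomogeneous_of_weightMap w fun k hk ↦ ?_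
    rcases lt_or_gt_of_ne hk with hk | hk
    · exact Polynomial.coeff_eq_zero_of_lt_natTrailingDegree (by omega)
    · exact Polynomial.coeff_eq_zero_of_natDegree_lt hk

end HomogeneousFactors

/-! ### The Ramanujan derivation on polynomials. -/

section Ramanujan

open MvPolynomial

/-- Evaluation of polynomials at `C₂, C₄, C₆`. -/
noncomputable abbrev evalC : MvPolynomial (Fin 3) ℂ →ₐ[ℂ] PowerSeries ℂ :=
  aeval ![eisensteinC 1, eisensteinC 2, eisensteinC 3]

/-- The derivation of `ℂ[C₂, C₄, C₆]` which lifts `q d/dq`. -/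
noncomputable def ramanujanDerivation :
    Derivation ℂ (MvPolynomial (Fin 3) ℂ) (MvPolynomial (Fin 3) ℂ) :=
  mkDerivation ℂ ![(-2 : ℂ) • (X 0 * X 0) + (10 : ℂ) • X 1, (-8 : ℂ) • (X 0 * X 1) + (21 : ℂ) • X 2,
    (-12 : ℂ) • (X 0 * X 2) + (160 / 7 : ℂ) • (X 1 * X 1)]

theorem evalC_ramanujanDerivation (f : MvPolynomial (Fin 3) ℂ) :
    evalC (ramanujanDerivation f) = qDerivative (evalC f) := by
  induction f using MvPolynomial.induction_on with
  | C a =>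
    rw [derivation_C, map_zero, algHom_C, Derivation.map_algebraMap]
  | add p q hp hq => simp only [map_add, hp, hq]
  | mul_X p i hp =>
    rw [Derivation.leibniz, map_add, smul_eq_mul, smul_eq_mul, map_mul, map_mul, hp, map_mul,
      Derivation.leibniz, smul_eq_mul, smul_eq_mul]
    congr 2
    rw [ramanujanDerivation, mkDerivation_X]
    fin_cases i
    · simpa using qDerivative_eisensteinC_one.symm
    · simpa using qDerivative_eisensteinC_two.symm
    · simpa using qDerivative_eisensteinC_three.symm

theorem isWeightedHomogeneous_smul {f : MvPolynomial (Fin 3) ℂ} {n : ℕ} (a : ℂ)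
    (hf : IsWeightedHomogeneous halfWeight f n) : IsWeightedHomogeneous halfWeight (a • f) n :=
  (weightedHomogeneousSubmodule ℂ halfWeight n).smul_mem a hf

theorem isWeightedHomogeneous_ramanujanDerivation_X (i : Fin 3) :
    IsWeightedHomogeneous halfWeight (ramanujanDerivation (X i)) (halfWeight i + 1) := by
  have h0 := isWeightedHomogeneous_X ℂ halfWeight 0
  have h1 := isWeightedHomogeneous_X ℂ halfWeight 1
  have h2 := isWeightedHomogeneous_X ℂ halfWeight 2
  rw [ramanujanDerivation, mkDerivation_X]
  fin_cases i
  · exact (isWeightedHomogeneous_smul _ (h0.mul h0)).add (isWeightedHomogeneous_smul _ h1)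
  · exact (isWeightedHomogeneous_smul _ (h0.mul h1)).add (isWeightedHomogeneous_smul _ h2)
  · exact (isWeightedHomogeneous_smul _ (h0.mul h2)).add (isWeightedHomogeneous_smul _ (h1.mul h1))

theorem isWeightedHomogeneous_ramanujanDerivation {f : MvPolynomial (Fin 3) ℂ} {n : ℕ}
    (hf : IsWeightedHomogeneous halfWeight f n) :
    IsWeightedHomogeneous halfWeight (ramanujanDerivation f) (n + 1) := by
  rw [f.as_sum, map_sum]
  refine IsWeightedHomogeneous.sum _ _ _ fun d hd ↦ ?_
  have hw := hf (mem_support_iff.mp hd)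
  rw [ramanujanDerivation, mkDerivation_monomial, Finsupp.sum]
  refine isWeightedHomogeneous_smul _ (IsWeightedHomogeneous.sum _ _ _ fun i hi ↦ ?_)
  have hX := isWeightedHomogeneous_ramanujanDerivation_X i
  rw [ramanujanDerivation, mkDerivation_X] at hX
  have hdi : Finsupp.single i 1 ≤ d := by
    simpa [Nat.one_le_iff_ne_zero] using hi
  have hs := congrArg (Finsupp.weight halfWeight) (tsub_add_cancel_of_le hdi)
  rw [map_add, hw, Finsupp.weight_single, one_smul] at hs
  have := (isWeightedHomogeneous_monomial halfWeight (d - Finsupp.single i 1) (d i : ℂ) rfl).mul hX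
  rwa [← add_assoc, hs] at this

end Ramanujan

/-! ### Order of vanishing: the coprime case. -/

section OrderBound

open MvPolynomial

/-- The discriminant `E₄³ - E₆²`, as a polynomial in `C₂, C₄, C₆`. -/
noncomputable def discPoly : MvPolynomial (Fin 3) ℂ :=
  (2880 ^ 3 : ℂ) • X 1 ^ 3 + (-181440 ^ 2 : ℂ) • X 2 ^ 2

theorem isWeightedHomogeneous_discPoly : IsWeightedHomogeneous halfWeight discPoly 6 :=
  (isWeightedHomogeneous_smul _ ((isWeightedHomogeneous_X ℂ halfWeight 1).pow 3)).add
    (isWeightedHomogeneous_smul _ ((isWeightedHomogeneous_X ℂ halfWeight 2).pow 2))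

theorem coeff_one_mul (f g : PowerSeries ℂ) : PowerSeries.coeff 1 (f * g) =
    PowerSeries.coeff 0 f * PowerSeries.coeff 1 g +
      PowerSeries.coeff 1 f * PowerSeries.coeff 0 g := by
  simp [PowerSeries.coeff_mul, Finset.Nat.antidiagonal_succ]

/-- Since `E₄³ - E₆² = 1728 q + ⋯`, its powers realise every order of vanishing exactly. -/
theorem exists_evalC_discPoly : ∃ u : PowerSeries ℂ, evalC discPoly = PowerSeries.X * u ∧
    PowerSeries.coeff 0 u = 1728 := by
  have h4 : PowerSeries.coeff 1 (eisensteinC 2) = 1 / 12 := by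
    rw [coeff_eisensteinC_of_ne_zero _ one_ne_zero]
    norm_num [Nat.factorial]
  have h6 : PowerSeries.coeff 1 (eisensteinC 3) = 1 / 360 := by
    rw [coeff_eisensteinC_of_ne_zero _ one_ne_zero]
    norm_num [Nat.factorial]
  have h : evalC discPoly = (2880 ^ 3 : ℂ) • (eisensteinC 2 * (eisensteinC 2 * eisensteinC 2)) +
      (-181440 ^ 2 : ℂ) • (eisensteinC 3 * eisensteinC 3) := by
    simp [discPoly, pow_succ, mul_assoc]
  have h0 : PowerSeries.constantCoeff (evalC discPoly) = 0 := by
    rw [← PowerSeries.coeff_zero_eq_constantCoeff_apply, h]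
    simp only [map_add, PowerSeries.coeff_smul, coeff_zero_mul, coeff_zero_eisensteinC_two,
      coeff_zero_eisensteinC_three]
    norm_num
  obtain ⟨u, hu⟩ := PowerSeries.X_dvd_iff.mpr h0
  refine ⟨u, hu, ?_⟩
  rw [← PowerSeries.coeff_succ_X_mul, ← hu, h]
  simp only [map_add, PowerSeries.coeff_smul, coeff_zero_mul, coeff_one_mul,
    coeff_zero_eisensteinC_two, coeff_zero_eisensteinC_three, zero_add, h4, h6]
  norm_num

/-- Power series are approximated to order `ν` by quasimodular forms of any large weight. -/
theorem exists_homPoly_approx (n ν : ℕ) (hn : 6 * ν ≤ n) (g : PowerSeries ℂ) :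
    ∃ p ∈ homPoly n, PowerSeries.X ^ ν ∣ g - evalC p := by
  induction ν with
  | zero => exact ⟨0, zero_mem _, by simp⟩
  | succ ν ih =>
    obtain ⟨p, hp, r, hr⟩ := ih (by omega)
    obtain ⟨u, hu, hu0⟩ := exists_evalC_discPoly
    -- The power of `C₂` fills up the weight; its constant term is nonzero, so the order stays
    -- exactly `ν`.
    set b : MvPolynomial (Fin 3) ℂ := X 0 ^ (n - 6 * ν) * discPoly ^ ν with hb
    have hbw : b ∈ homPoly n := by
      have := ((isWeightedHomogeneous_X ℂ halfWeight 0).pow (n - 6 * ν)).mul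
        (isWeightedHomogeneous_discPoly.pow ν)
      have hnn : (n - 6 * ν) • halfWeight 0 + ν • 6 = n := by simp; omega
      rwa [hnn] at this
    have hev : evalC b = PowerSeries.X ^ ν * (eisensteinC 1 ^ (n - 6 * ν) * u ^ ν) := by
      rw [hb, map_mul, map_pow, map_pow, hu, mul_pow]
      simp
      ring
    set s := eisensteinC 1 ^ (n - 6 * ν) * u ^ ν with hs
    have hs0 : PowerSeries.constantCoeff s ≠ 0 := by
      rw [hs, map_mul, map_pow, map_pow, ← PowerSeries.coeff_zero_eq_constantCoeff_apply,
        ← PowerSeries.coeff_zero_eq_constantCoeff_apply, hu0, coeff_zero_eisensteinC_one]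
      exact mul_ne_zero (pow_ne_zero _ (by norm_num)) (pow_ne_zero _ (by norm_num))
    set a := PowerSeries.constantCoeff r / PowerSeries.constantCoeff s with ha
    refine ⟨p + a • b, add_mem hp (Submodule.smul_mem _ _ hbw), ?_⟩
    have : g - evalC (p + a • b) = PowerSeries.X ^ ν * (r - a • s) := by
      rw [map_add, map_smul, hev, ← sub_sub, hr, mul_sub, mul_smul_comm]
    rw [this, pow_succ]
    refine mul_dvd_mul_left _ (PowerSeries.X_dvd_iff.mpr ?_)
    rw [map_sub, ← PowerSeries.coeff_zero_eq_constantCoeff_apply,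
      ← PowerSeries.coeff_zero_eq_constantCoeff_apply, PowerSeries.coeff_smul,
      PowerSeries.coeff_zero_eq_constantCoeff_apply, PowerSeries.coeff_zero_eq_constantCoeff_apply,
      smul_eq_mul, ha, div_mul_cancel₀ _ hs0, sub_self]

/-- The first `ν` coefficients of a quasimodular form. -/
noncomputable def truncEval (ν : ℕ) : MvPolynomial (Fin 3) ℂ →ₗ[ℂ] (Fin ν → ℂ) :=
  LinearMap.pi fun j ↦ (PowerSeries.coeff (j : ℕ)).comp evalC.toLinearMap

theorem mem_ker_truncEval {ν : ℕ} {p : MvPolynomial (Fin 3) ℂ} :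
    p ∈ LinearMap.ker (truncEval ν) ↔ PowerSeries.X ^ ν ∣ evalC p := by
  rw [LinearMap.mem_ker, PowerSeries.X_pow_dvd_iff, funext_iff]
  exact ⟨fun h m hm ↦ h ⟨m, hm⟩, fun h j ↦ h j j.2⟩

/-- In large weight the `ν` vanishing conditions are independent: their common kernel has
codimension exactly `ν`. -/
theorem finrank_ker_truncEval (n ν : ℕ) (hn : 6 * ν ≤ n) :
    Module.finrank ℂ (LinearMap.ker ((truncEval ν).domRestrict (homPoly n))) + ν =
      numMonomials n := by
  have hs : LinearMap.range ((truncEval ν).domRestrict (homPoly n)) = ⊤ := by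
    rw [LinearMap.range_eq_top]
    intro y
    obtain ⟨p, hp, h⟩ := exists_homPoly_approx n ν hn
      (PowerSeries.mk fun i ↦ if h : i < ν then y ⟨i, h⟩ else 0)
    refine ⟨⟨p, hp⟩, ?_⟩
    ext j
    have := PowerSeries.X_pow_dvd_iff.mp h j j.2
    rw [map_sub, PowerSeries.coeff_mk, dif_pos j.2, sub_eq_zero] at this
    exact this.symm
  have h := LinearMap.finrank_range_add_finrank_ker ((truncEval ν).domRestrict (homPoly n))
  rw [hs, finrank_top, Module.finrank_fin_fun, finrank_homPoly] at h
  omega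

/-- A bound for the order of vanishing of two coprime quasimodular forms. -/
theorem order_le_of_coprime {f g : MvPolynomial (Fin 3) ℂ} {v ν : ℕ} (hf : Prime f)
    (hfg : ¬ f ∣ g) (hfw : f ∈ homPoly v) (hgw : g ∈ homPoly (v + 1))
    (hfν : PowerSeries.X ^ ν ∣ evalC f) (hgν : PowerSeries.X ^ ν ∣ evalC g) (n : ℕ)
    (hn : 6 * ν ≤ n) :
    ν + numMonomials (n + v + 1) + numMonomials (n + v) ≤
      numMonomials (n + 2 * v + 1) + numMonomials n := by
  -- Every `f A + g B` vanishes to order `ν`, so the image of `Φ` has codimension at least `ν` in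
  -- its weight.
  let Φ : homPoly (n + v + 1) × homPoly (n + v) →ₗ[ℂ] MvPolynomial (Fin 3) ℂ :=
    ((LinearMap.mulLeft ℂ f).comp (homPoly (n + v + 1)).subtype).coprod
      ((LinearMap.mulLeft ℂ g).comp (homPoly (n + v)).subtype)
  have hΦ : ∀ x, Φ x = f * x.1 + g * x.2 := fun x ↦ rfl
  have hΦw : ∀ x, Φ x ∈ homPoly (n + 2 * v + 1) := by
    intro x
    rw [hΦ]
    have h1 : f * x.1.1 ∈ homPoly (v + (n + v + 1)) := IsWeightedHomogeneous.mul hfw x.1.2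
    have h2 : g * x.2.1 ∈ homPoly (v + 1 + (n + v)) := IsWeightedHomogeneous.mul hgw x.2.2
    rw [show v + (n + v + 1) = n + 2 * v + 1 by ring] at h1
    rw [show v + 1 + (n + v) = n + 2 * v + 1 by ring] at h2
    exact add_mem h1 h2
  let Φ' : homPoly (n + v + 1) × homPoly (n + v) →ₗ[ℂ] homPoly (n + 2 * v + 1) :=
    Φ.codRestrict _ hΦw
  have hrange : LinearMap.range Φ' ≤
      LinearMap.ker ((truncEval ν).domRestrict (homPoly (n + 2 * v + 1))) := by
    rintro _ ⟨x, rfl⟩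
    have : Φ x ∈ LinearMap.ker (truncEval ν) := by
      rw [mem_ker_truncEval, hΦ, map_add, map_mul, map_mul]
      exact dvd_add (hfν.mul_right _) (hgν.mul_right _)
    exact this
  -- Only Koszul syzygies occur: `f A + g B = 0` forces `B = f b` with `b` of weight `n`, and `B`
  -- determines `A`.
  have hker : Module.finrank ℂ (LinearMap.ker Φ') ≤ numMonomials n := by
    have hex : ∀ x : LinearMap.ker Φ', ∃ b ∈ homPoly n, x.1.2.1 = f * b := by
      rintro ⟨x, hx⟩
      have h0 : f * x.1.1 + g * x.2.1 = 0 := congrArg Subtype.val hx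
      have hd : f ∣ g * x.2.1 := ⟨-x.1.1, by linear_combination h0⟩
      obtain ⟨b, hb⟩ := (hf.dvd_or_dvd hd).resolve_left hfg
      rcases eq_or_ne b 0 with rfl | hb0
      · exact ⟨0, zero_mem _, hb⟩
      · obtain ⟨i, j, hij, h1, h2⟩ := isWeightedHomogeneous_of_mul halfWeight
          (mul_ne_zero hf.ne_zero hb0) (hb ▸ x.2.2)
        have := h1.inj_right hf.ne_zero hfw
        obtain rfl : j = n := by omega
        exact ⟨b, h2, hb⟩
    let M : homPoly n →ₗ[ℂ] MvPolynomial (Fin 3) ℂ :=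
      (LinearMap.mulLeft ℂ f).comp (homPoly n).subtype
    let S : LinearMap.ker Φ' →ₗ[ℂ] MvPolynomial (Fin 3) ℂ :=
      (homPoly (n + v)).subtype.comp
        ((LinearMap.snd ℂ _ _).comp (LinearMap.ker Φ').subtype)
    have hS : Function.Injective S := by
      rw [injective_iff_map_eq_zero]
      rintro ⟨⟨x, y⟩, hx⟩ hy
      have hy0 : y.1 = 0 := hy
      have h0 : f * x.1 + g * y.1 = 0 := congrArg Subtype.val hx
      rw [hy0, mul_zero, add_zero] at h0
      have hx0 := (mul_eq_zero.mp h0).resolve_left hf.ne_zero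
      ext1
      exact Prod.ext (Subtype.ext hx0) (Subtype.ext hy0)
    have hSM : LinearMap.range S ≤ LinearMap.range M := by
      rintro _ ⟨x, rfl⟩
      obtain ⟨b, hb, hxb⟩ := hex x
      exact ⟨⟨b, hb⟩, hxb.symm⟩
    rw [← LinearMap.finrank_range_of_inj hS, ← finrank_homPoly]
    exact (Submodule.finrank_mono hSM).trans (LinearMap.finrank_range_le M)
  have h1 := LinearMap.finrank_range_add_finrank_ker Φ'
  rw [Module.finrank_prod, finrank_homPoly, finrank_homPoly] at h1
  have h2 := Submodule.finrank_mono hrange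
  have h3 := finrank_ker_truncEval (n + 2 * v + 1) ν (by omega)
  omega

/-- Summing the dimension inequality over six consecutive weights leaves a second difference of a
quadratic, in which `n` cancels. -/
theorem six_mul_order_le_of_coprime {f g : MvPolynomial (Fin 3) ℂ} {v ν : ℕ} (hf : Prime f)
    (hfg : ¬ f ∣ g) (hfw : f ∈ homPoly v) (hgw : g ∈ homPoly (v + 1))
    (hfν : PowerSeries.X ^ ν ∣ evalC f) (hgν : PowerSeries.X ^ ν ∣ evalC g) :
    6 * ν ≤ v * (v + 1) := by
  set n := 6 * ν with hn
  have h (i : ℕ) := order_le_of_coprime hf hfg hfw hgw hfν hgν (n + i) (by omega)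
  have hs := Finset.sum_le_sum fun i (_ : i ∈ Finset.range 6) ↦ h i
  simp only [Finset.sum_add_distrib, Finset.sum_const, Finset.card_range, smul_eq_mul] at hs
  have s0 := sum_numMonomials n
  have s1 := sum_numMonomials (n + v)
  have s2 := sum_numMonomials (n + v + 1)
  have s3 := sum_numMonomials (n + 2 * v + 1)
  have e1 (i : ℕ) : n + i + v = n + v + i := by ring
  have e2 (i : ℕ) : n + v + i + 1 = n + v + 1 + i := by ring
  have e3 (i : ℕ) : n + i + 2 * v + 1 = n + 2 * v + 1 + i := by ring
  simp only [e1, e2, e3] at hs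
  nlinarith

end OrderBound

/-! ### Order of vanishing: eigenvectors of the derivation, and the general case. -/

section OrderBound

open MvPolynomial

/-- Splits off `C₂` times an operator diagonal on monomials; the remainder does not raise the degree
in `C₂`. -/
theorem ramanujanDerivation_eq (f : MvPolynomial (Fin 3) ℂ) : ramanujanDerivation f =
    X 0 * ((-2 : ℂ) • (X 0 * pderiv 0 f) + (-8 : ℂ) • (X 1 * pderiv 1 f) +
      (-12 : ℂ) • (X 2 * pderiv 2 f)) + ((10 : ℂ) • (X 1 * pderiv 0 f) +
        (21 : ℂ) • (X 2 * pderiv 1 f) + (160 / 7 : ℂ) • (X 1 * X 1 * pderiv 2 f)) := by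
  have h : ramanujanDerivation =
      ((-2 : ℂ) • (X 0 * X 0) + (10 : ℂ) • X 1 : MvPolynomial (Fin 3) ℂ) • pderiv 0 +
      ((-8 : ℂ) • (X 0 * X 1) + (21 : ℂ) • X 2 : MvPolynomial (Fin 3) ℂ) • pderiv 1 +
      ((-12 : ℂ) • (X 0 * X 2) + (160 / 7 : ℂ) • (X 1 * X 1) : MvPolynomial (Fin 3) ℂ) •
        pderiv 2 := by
    refine derivation_ext fun i ↦ ?_
    rw [ramanujanDerivation, mkDerivation_X]
    fin_cases i <;> simp [pderiv_X]
  rw [h]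
  simp only [Derivation.add_apply, Derivation.smul_apply, smul_eq_mul, smul_eq_C_mul]
  ring

/-- The leading term of the Ramanujan derivation with respect to the degree in `C₂`. -/
theorem coeff_ramanujanDerivation {f : MvPolynomial (Fin 3) ℂ} {m : Fin 3 →₀ ℕ}
    (hm : ∀ s ∈ f.support, s 0 ≤ m 0) :
    coeff (m + Finsupp.single 0 1) (ramanujanDerivation f) =
      -(2 * m 0 + 8 * m 1 + 12 * m 2) * coeff m f := by
  have key : ∀ s ∈ f.support, ∀ r : ℂ,
      coeff (m + Finsupp.single 0 1) (ramanujanDerivation (monomial s r)) =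
        -(2 * m 0 + 8 * m 1 + 12 * m 2) * coeff m (monomial s r) := by
    intro s hs r
    have h0 := hm s hs
    rw [ramanujanDerivation_eq, X_mul_pderiv_monomial, X_mul_pderiv_monomial,
      X_mul_pderiv_monomial, coeff_add, add_comm m, coeff_X_mul]
    have hlow (t : Fin 3 →₀ ℕ) (ht : t 0 ≤ s 0) (a : ℂ) :
        coeff (Finsupp.single 0 1 + m) (monomial t a) = 0 := by
      rw [coeff_monomial, if_neg]
      rintro rfl
      simp at ht
      omega
    have h1 : coeff (Finsupp.single 0 1 + m) ((10 : ℂ) • (X 1 * pderiv 0 (monomial s r)) +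
        (21 : ℂ) • (X 2 * pderiv 1 (monomial s r)) +
        (160 / 7 : ℂ) • (X 1 * X 1 * pderiv 2 (monomial s r))) = 0 := by
      simp only [pderiv_monomial, X, monomial_mul, coeff_add, coeff_smul]
      rw [hlow, hlow, hlow] <;> simp
    rw [h1, add_zero]
    simp only [coeff_add, coeff_smul, coeff_monomial]
    simp only [smul_eq_mul, nsmul_eq_mul]
    split_ifs with h
    · subst h; ring
    · simp
  conv_lhs => rw [f.as_sum]
  conv_rhs => rw [f.as_sum]
  rw [map_sum, coeff_sum, coeff_sum, Finset.mul_sum]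
  exact Finset.sum_congr rfl fun s hs ↦ key s hs _

theorem exists_eq_smul_X_of_weight_one {h : MvPolynomial (Fin 3) ℂ} (hh : h ∈ homPoly 1) :
    ∃ c : ℂ, h = c • X 0 := by
  refine ⟨coeff (Finsupp.single 0 1) h, ?_⟩
  have := IsWeightedHomogeneous.eq_monomial_of_unique_weight (d₀ := Finsupp.single 0 1) hh ?_
  · rw [this, X, smul_monomial]
    simp
  · intro d hd
    rw [weight_halfWeight] at hd
    ext i
    fin_cases i <;> simp <;> omega

/-- The bound for the order of vanishing of an eigenvector of the Ramanujan derivation. -/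
theorem order_le_of_dvd {f : MvPolynomial (Fin 3) ℂ} {v ν : ℕ}
    (hfg : f ∣ ramanujanDerivation f) (hfw : f ∈ homPoly v) (hf0 : evalC f ≠ 0)
    (hfν : PowerSeries.X ^ ν ∣ evalC f) : 6 * ν ≤ v := by
  have hf : f ≠ 0 := by
    rintro rfl
    simp at hf0
  obtain ⟨c, hc⟩ : ∃ c : ℂ, ramanujanDerivation f = c • (X 0 * f) := by
    rcases eq_or_ne (ramanujanDerivation f) 0 with h0 | h0
    · exact ⟨0, by rw [h0, zero_smul]⟩
    -- The quotient `Df / f` has halved weight 1, hence is a multiple of `C₂`.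
    · obtain ⟨h, hh⟩ := hfg
      have hw := isWeightedHomogeneous_ramanujanDerivation hfw
      rw [hh] at hw h0
      obtain ⟨i, j, hij, h1, h2⟩ := isWeightedHomogeneous_of_mul halfWeight h0 hw
      have := h1.inj_right hf hfw
      obtain rfl : j = 1 := by omega
      obtain ⟨c, rfl⟩ := exists_eq_smul_X_of_weight_one h2
      exact ⟨c, by rw [hh, mul_smul_comm, mul_comm]⟩
  obtain ⟨m, hm, hmax⟩ := f.support.exists_max_image (fun s ↦ s 0) (support_nonempty.mpr hf)
  have h1 := coeff_ramanujanDerivation hmax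
  rw [hc, coeff_smul, add_comm m, coeff_X_mul, smul_eq_mul] at h1
  have h2 := mul_right_cancel₀ (mem_support_iff.mp hm) h1
  set e := (evalC f).order.toNat with he
  have hetop : (evalC f).order ≠ ⊤ := by simpa [PowerSeries.order_eq_top] using hf0
  have hcoe : PowerSeries.coeff e (evalC f) ≠ 0 := PowerSeries.coeff_order hf0
  have hlt (i : ℕ) (hi : i < e) : PowerSeries.coeff i (evalC f) = 0 :=
    PowerSeries.coeff_of_lt_order_toNat i hi
  -- At the leading power `q^e` only the constant term `-1/24` of `C₂` contributes, so `e = -c/24`.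
  have h3 := congrArg (PowerSeries.coeff e) (congrArg evalC hc)
  rw [evalC_ramanujanDerivation, coeff_qDerivative, map_smul, map_mul, PowerSeries.coeff_smul,
    PowerSeries.coeff_mul, Finset.sum_eq_single (0, e)] at h3
  · have hX : evalC (X 0) = eisensteinC 1 := by simp
    rw [hX, coeff_zero_eisensteinC_one, smul_eq_mul, ← mul_assoc] at h3
    have h4 := mul_right_cancel₀ hcoe h3
    have hν : ν ≤ e := by
      by_contra hlt'
      exact hcoe (PowerSeries.X_pow_dvd_iff.mp hfν e (by omega))
    have hmw := hfw (mem_support_iff.mp hm)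
    rw [weight_halfWeight] at hmw
    -- The right side is at most `4 (m 0 + 2 m 1 + 3 m 2) = 4v`, whence `6e ≤ v`.
    have h5 : ((24 * e : ℕ) : ℂ) = ((2 * m 0 + 8 * m 1 + 12 * m 2 : ℕ) : ℂ) := by
      push_cast
      rw [h4, h2]
      ring
    have h6 := Nat.cast_injective h5
    omega
  · rintro ⟨i, j⟩ hij hne
    rw [Finset.HasAntidiagonal.mem_antidiagonal] at hij
    have hi : i ≠ 0 := by
      rintro rfl
      exact hne (by simpa using hij)
    simp only at hij ⊢
    rw [hlt j (by omega), mul_zero]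
  · simp

/-- A nonzero quasimodular form of weight `2v` vanishes at `q = 0` to order at most
`v (v + 1) / 6`. -/
theorem six_mul_order_le {p : MvPolynomial (Fin 3) ℂ} {v ν : ℕ} (hp : p ∈ homPoly v)
    (hp0 : evalC p ≠ 0) (hν : PowerSeries.X ^ ν ∣ evalC p) : 6 * ν ≤ v * (v + 1) := by
  induction p using UniqueFactorizationMonoid.induction_on_prime generalizing v ν with
  | h₁ => simp at hp0
  | h₂ u hu =>
    have hu' := hu.map evalC
    rcases Nat.eq_zero_or_pos ν with rfl | h
    · simp
    · exact absurd (isUnit_of_dvd_unit (dvd_of_mul_right_dvd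
        (by rw [← Nat.succ_pred_eq_of_pos h, pow_succ'] at hν; exact hν)) hu')
        PowerSeries.X_prime.not_isUnit
  | h₃ a f ha hf ih =>
    have hne : f * a ≠ 0 := by
      intro h
      rw [h, map_zero] at hp0
      exact hp0 rfl
    obtain ⟨i, j, rfl, hfw, haw⟩ := isWeightedHomogeneous_of_mul halfWeight hne hp
    rw [map_mul] at hν hp0
    have hf0 := left_ne_zero_of_mul hp0
    have ha0 := right_ne_zero_of_mul hp0
    obtain ⟨s, t, hst, hs, ht⟩ : ∃ s t, ν ≤ s + t ∧ PowerSeries.X ^ s ∣ evalC f ∧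
        PowerSeries.X ^ t ∣ evalC a := by
      refine ⟨_, _, ?_, PowerSeries.X_pow_order_dvd, PowerSeries.X_pow_order_dvd⟩
      by_contra! hlt
      have h := PowerSeries.X_pow_dvd_iff.mp hν _ hlt
      rw [← ENat.toNat_add (by simpa using hf0) (by simpa using ha0), ← PowerSeries.order_mul] at h
      exact PowerSeries.coeff_order hp0 h
    have h1 := ih haw ha0 ht
    have h2 : 6 * s ≤ i * (i + 1) := by
      by_cases hd : f ∣ ramanujanDerivation f
      · have := order_le_of_dvd hd hfw hf0 hs
        nlinarith
      · refine six_mul_order_le_of_coprime hf hd hfw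
          (isWeightedHomogeneous_ramanujanDerivation hfw) hs ?_
        rw [evalC_ramanujanDerivation, PowerSeries.X_pow_dvd_iff]
        intro k hk
        rw [coeff_qDerivative, PowerSeries.X_pow_dvd_iff.mp hs k hk, mul_zero]
    -- Superadditivity: `i(i+1) + j(j+1) ≤ (i+j)(i+j+1)`.
    nlinarith

end OrderBound

/-! ### Laurent polynomials in `y = -e^{iu}`. -/

section Exponential

theorem coeff_negExp (n : ℕ) : PowerSeries.coeff n negExp =
    -(Complex.I ^ n * (algebraMap ℚ ℂ (1 / (n.factorial : ℚ)))) := by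
  simp [negExp, PowerSeries.coeff_exp]

theorem constantCoeff_negExp : PowerSeries.constantCoeff negExp = -1 := by
  rw [← PowerSeries.coeff_zero_eq_constantCoeff_apply, coeff_negExp]
  simp

theorem exists_negExp_add_one : ∃ u : PowerSeries ℂ, negExp + 1 = PowerSeries.X * u ∧
    PowerSeries.constantCoeff u ≠ 0 := by
  obtain ⟨u, hu⟩ : (PowerSeries.X : PowerSeries ℂ) ∣ negExp + 1 := by
    rw [PowerSeries.X_dvd_iff, map_add, constantCoeff_negExp, map_one, neg_add_cancel]
  refine ⟨u, hu, ?_⟩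
  rw [← PowerSeries.coeff_zero_eq_constantCoeff_apply, ← PowerSeries.coeff_succ_X_mul, ← hu,
    map_add, coeff_negExp]
  simp [PowerSeries.coeff_one]

theorem constantCoeff_aeval_negExp (S : Polynomial ℂ) :
    PowerSeries.constantCoeff (Polynomial.aeval negExp S) = S.eval (-1) := by
  rw [Polynomial.aeval_def, Polynomial.hom_eval₂, constantCoeff_negExp]
  have : (PowerSeries.constantCoeff (R := ℂ)).comp (algebraMap ℂ (PowerSeries ℂ)) =
      RingHom.id ℂ := by
    ext; simp
  rw [this]
  rfl

/-- A polynomial of degree `d` in `-e^{iu}` vanishes at `u = 0` to order at most `d`. -/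
theorem le_natDegree_of_X_pow_dvd_aeval_negExp {P : Polynomial ℂ} (hP : P ≠ 0) {k : ℕ}
    (hk : PowerSeries.X ^ k ∣ Polynomial.aeval negExp P) : k ≤ P.natDegree := by
  -- As `y + 1` has a simple zero at `u = 0`, the order in `u` is the multiplicity of the root `y =
  -- -1`.
  obtain ⟨S, hS, hdvd⟩ := P.exists_eq_pow_rootMultiplicity_mul_and_not_dvd hP (-1)
  obtain ⟨u, hu, hu0⟩ := exists_negExp_add_one
  set j := P.rootMultiplicity (-1) with hj
  have hjP : j ≤ P.natDegree := by
    rw [hj, ← Polynomial.count_roots]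
    exact (Multiset.count_le_card _ _).trans P.card_roots'
  refine le_trans ?_ hjP
  have hev : Polynomial.aeval negExp P =
      PowerSeries.X ^ j * (u ^ j * Polynomial.aeval negExp S) := by
    conv_lhs => rw [hS]
    rw [map_mul, map_pow, map_sub, Polynomial.aeval_X, Polynomial.aeval_C, map_neg, map_one,
      sub_neg_eq_add, hu, mul_pow, mul_assoc]
  rw [hev, PowerSeries.X_pow_dvd_iff] at hk
  by_contra! hlt
  have h := hk j hlt
  rw [PowerSeries.coeff_X_pow_mul', if_pos le_rfl, Nat.sub_self,
    PowerSeries.coeff_zero_eq_constantCoeff_apply, map_mul, map_pow,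
    constantCoeff_aeval_negExp] at h
  rcases mul_eq_zero.mp h with h | h
  · exact pow_ne_zero _ hu0 h
  · exact hdvd (Polynomial.dvd_iff_isRoot.mpr h)

/-- A rational function with a finite Laurent expansion is a Laurent polynomial. -/
theorem IsLaurentExpansion.exists_polynomial {R : RatFunc ℂ} {c : ℤ → ℂ}
    (h : IsLaurentExpansion R c) {d : ℕ} (hc : ∀ r : ℤ, (d : ℤ) < |r| → c r = 0) :
    ∃ P : Polynomial ℂ, P.natDegree ≤ 2 * d ∧ Polynomial.X ^ d * R.num = P * R.denom := by
  obtain ⟨a, b, ha, hab, hR⟩ := h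
  -- This is `y^d ∑ c(r) y^r`, with `k = r + d`; the identity is checked at the infinitely many real
  -- points of the annulus.
  refine ⟨∑ k ∈ Finset.range (2 * d + 1), Polynomial.C (c (k - d)) * Polynomial.X ^ k, ?_, ?_⟩
  · refine Polynomial.natDegree_sum_le_of_forall_le _ _ fun k hk ↦ ?_
    rw [Finset.mem_range] at hk
    exact (Polynomial.natDegree_C_mul_X_pow_le _ _).trans (by omega)
  · refine Polynomial.eq_of_infinite_eval_eq _ _ (Set.Infinite.mono ?_
      ((Set.Ioo_infinite hab).image (Complex.ofReal_injective.injOn)))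
    rintro _ ⟨x, ⟨hax, hxb⟩, rfl⟩
    have hx0 : 0 < x := ha.trans_lt hax
    have hn : ‖(x : ℂ)‖ = x := by rw [Complex.norm_real, Real.norm_of_nonneg hx0.le]
    obtain ⟨hd, hs⟩ := hR x (hn.symm ▸ hax) (hn.symm ▸ hxb)
    have hxc : (x : ℂ) ≠ 0 := Complex.ofReal_ne_zero.mpr hx0.ne'
    have hinj : Set.InjOn (fun k : ℕ ↦ (k : ℤ) - d) (Finset.range (2 * d + 1)) := by
      intro k _ l _ hkl
      simpa using hkl
    have hfin := hasSum_sum_of_ne_finset_zero (L := .unconditional ℤ)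
      (f := fun r : ℤ ↦ c r * (x : ℂ) ^ r)
      (s := (Finset.range (2 * d + 1)).image fun k : ℕ ↦ (k : ℤ) - d) (by
        intro r hr
        rw [hc r, zero_mul]
        by_contra! hle
        rw [abs_le] at hle
        refine hr (Finset.mem_image.mpr ⟨(r + d).toNat, ?_, ?_⟩)
        · rw [Finset.mem_range]; omega
        · omega)
    have heq := hs.unique hfin
    rw [Finset.sum_image hinj, RatFunc.eval, Polynomial.eval₂_id, Polynomial.eval₂_id,
      div_eq_iff hd] at heq
    change Polynomial.eval _ _ = Polynomial.eval _ _
    simp only [Polynomial.eval_mul, Polynomial.eval_pow, Polynomial.eval_X,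
      Polynomial.eval_finsetSum, Polynomial.eval_C]
    rw [heq, ← mul_assoc, Finset.mul_sum]
    congr 1
    refine Finset.sum_congr rfl fun k _ ↦ ?_
    rw [zpow_sub₀ hxc, zpow_natCast, zpow_natCast]
    field_simp

theorem coe_aeval_negExp (P : Polynomial ℂ) :
    ((Polynomial.aeval negExp P : PowerSeries ℂ) : LaurentSeries ℂ) =
      P.eval₂ (algebraMap ℂ (LaurentSeries ℂ)) (negExp : LaurentSeries ℂ) := by
  have h := Polynomial.hom_eval₂ P (algebraMap ℂ (PowerSeries ℂ))
    (HahnSeries.ofPowerSeries ℤ ℂ) negExp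
  rw [← Polynomial.aeval_def] at h
  refine h.trans ?_
  congr 1

theorem mul_negExp_pow_eq {f : PowerSeries ℂ} {R : RatFunc ℂ}
    (hf : (f : LaurentSeries ℂ) = substNegExp R) {P : Polynomial ℂ} {d : ℕ}
    (hP : Polynomial.X ^ d * R.num = P * R.denom) :
    negExp ^ d * f = Polynomial.aeval negExp P := by
  have hden := aeval_negExp_ne_zero R.denom R.denom_ne_zero
  have hden' : ((Polynomial.aeval negExp R.denom : PowerSeries ℂ) : LaurentSeries ℂ) ≠ 0 := by
    intro h
    exact hden (HahnSeries.ofPowerSeries_injective (h.trans (map_zero _).symm))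
  rw [substNegExp, RatFunc.eval, ← coe_aeval_negExp, ← coe_aeval_negExp, eq_div_iff hden'] at hf
  have hf' : f * Polynomial.aeval negExp R.denom = Polynomial.aeval negExp R.num := by
    apply HahnSeries.ofPowerSeries_injective (Γ := ℤ)
    rw [map_mul]
    exact hf
  apply mul_right_cancel₀ hden
  rw [mul_assoc, hf', ← map_mul, ← hP, map_mul, map_pow, Polynomial.aeval_X]

theorem negExp_ne_zero : negExp ≠ 0 := by
  intro h
  have := constantCoeff_negExp
  rw [h, map_zero] at this
  norm_num at this

/-- The order of vanishing at `u = 0` of a nonzero Laurent polynomial in `-e^{iu}`. -/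
theorem le_two_mul_of_X_pow_dvd {f : PowerSeries ℂ} {R : RatFunc ℂ} {c : ℤ → ℂ}
    (hf : (f : LaurentSeries ℂ) = substNegExp R) (hc : IsLaurentExpansion R c) {d : ℕ}
    (hd : ∀ r : ℤ, (d : ℤ) < |r| → c r = 0) (hf0 : f ≠ 0) {k : ℕ}
    (hk : PowerSeries.X ^ k ∣ f) : k ≤ 2 * d := by
  obtain ⟨P, hPd, hP⟩ := hc.exists_polynomial hd
  have h := mul_negExp_pow_eq hf hP
  refine (le_natDegree_of_X_pow_dvd_aeval_negExp ?_ (h ▸ hk.mul_left _)).trans hPd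
  rintro rfl
  rw [map_zero] at h
  exact mul_ne_zero (pow_ne_zero _ negExp_ne_zero) hf0 h

end Exponential

/-! ### Combining the two order bounds. -/

/-- A nonzero quasimodular form has nonnegative even weight. -/
theorem exists_homPoly_of_mem_QMod {w : ℤ} {f : PowerSeries ℂ} (hf : f ∈ QMod w) (hf0 : f ≠ 0) :
    ∃ v : ℕ, w = 2 * v ∧ ∃ p ∈ homPoly v, evalC p = f := by
  obtain ⟨p, hp, rfl⟩ := hf
  have hweight (d : Fin 3 →₀ ℕ) : Finsupp.weight (![2, 4, 6] : Fin 3 → ℤ) d =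
      2 * (Finsupp.weight halfWeight d : ℕ) := by
    rw [weight_halfWeight, Finsupp.weight_apply, Finsupp.sum_fintype _ _ (by simp),
      Fin.sum_univ_three]
    simp
    ring
  have hp0 : p ≠ 0 := by
    rintro rfl
    exact hf0 (map_zero _)
  obtain ⟨d, hd⟩ := MvPolynomial.support_nonempty.mpr hp0
  have hw := hp (MvPolynomial.mem_support_iff.mp hd)
  rw [hweight] at hw
  refine ⟨_, hw.symm, p, fun e he ↦ ?_, rfl⟩
  have he' := hp he
  rw [hweight, ← hw] at he'
  omega

end QuasiModularSeries

open QuasiModularSeries in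
theorem mainTheorem7 (σ : ℤ) (hσ : Even σ)
    (F : PowerSeries (PowerSeries ℂ))
    (hweight : ∀ m : ℕ, PowerSeries.coeff m F ∈ QuasiModularSeries.QMod ((m : ℤ) + σ))
    (R : ℕ → RatFunc ℂ) (c : ℕ → ℤ → ℂ)
    (hrational : ∀ n : ℕ,
      ((QuasiModularSeries.qCoeff F n : PowerSeries ℂ) : LaurentSeries ℂ) =
        QuasiModularSeries.substNegExp (R n))
    (hexpansion : ∀ n : ℕ, QuasiModularSeries.IsLaurentExpansion (R n) (c n))
    (hbound : ∀ (n : ℕ) (r : ℤ), ¬ r ^ 2 ≤ 4 * (n : ℤ) + 1 → c n r = 0)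
    (hvanish : ∀ m : ℕ, (m : ℤ) ≤ QuasiModularSeries.vanishingBound σ →
      PowerSeries.coeff m F = 0) :
    F = 0 := by
  by_contra hF
  obtain ⟨t, rfl⟩ := hσ
  have hex : ∃ m, PowerSeries.coeff m F ≠ 0 := by
    by_contra! h
    exact hF (PowerSeries.ext h)
  classical
  set m := Nat.find hex with hm
  have hm0 : PowerSeries.coeff m F ≠ 0 := Nat.find_spec hex
  have hmin (i : ℕ) (hi : i < m) : PowerSeries.coeff i F = 0 := not_not.mp (Nat.find_min hex hi)
  obtain ⟨v, hv, p, hp, hpe⟩ := exists_homPoly_of_mem_QMod (hweight m) hm0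
  set N := (PowerSeries.coeff m F).order.toNat with hN
  have hNv : 6 * N ≤ v * (v + 1) :=
    six_mul_order_le hp (hpe ▸ hm0) (hpe ▸ PowerSeries.X_pow_order_dvd)
  have hFN : PowerSeries.coeff m (qCoeff F N) ≠ 0 := by
    rw [qCoeff, PowerSeries.coeff_mk]
    exact PowerSeries.coeff_order hm0
  have hFdvd : PowerSeries.X ^ m ∣ qCoeff F N := by
    rw [PowerSeries.X_pow_dvd_iff]
    intro i hi
    rw [qCoeff, PowerSeries.coeff_mk, hmin i hi, map_zero]
  have hsqrt := Nat.sqrt_le' (4 * N + 1)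
  have hmd : m ≤ 2 * Nat.sqrt (4 * N + 1) := by
    refine le_two_mul_of_X_pow_dvd (hrational N) (hexpansion N) (fun r hr ↦ hbound N r fun hr2 ↦ ?_)
      (fun h ↦ hFN (by rw [h, map_zero])) hFdvd
    have h1 := Nat.lt_succ_sqrt' (4 * N + 1)
    have h2 : ((Nat.sqrt (4 * N + 1) : ℤ) + 1) ^ 2 ≤ r ^ 2 := by
      rw [← sq_abs r]
      exact pow_le_pow_left₀ (by positivity) hr 2
    zify at h1
    linarith
  set d := Nat.sqrt (4 * N + 1) with hd
  have hB : vanishingBound (t + t) < m := by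
    by_contra! h
    exact hm0 (hvanish m h)
  -- With `σ = 2t` and `m + σ = 2v`, `m` is even, so the factor 2 in `B(σ)` cancels and the floor
  -- can be dropped.
  obtain ⟨β, hβ⟩ : ∃ β : ℤ, (m : ℤ) = 2 * β := ⟨v - t, by omega⟩
  rw [vanishingBound, hβ] at hB
  have hB' := Int.floor_lt.mp (lt_of_mul_lt_mul_left hB (by norm_num))
  have hroot : Real.sqrt (2 * ((t + t : ℤ) : ℝ) ^ 2 + 3 * ((t + t : ℤ) : ℝ) + 4) <
      β - ((t + t : ℤ) : ℝ) - 1 := by linarith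
  have hpos := (Real.sqrt_nonneg _).trans_lt hroot
  have hq := (Real.sqrt_lt' hpos).mp hroot
  have hqZ : 2 * (t + t) ^ 2 + 3 * (t + t) + 4 < (β - (t + t) - 1) ^ 2 := by exact_mod_cast hq
  have hβd : β ≤ d := by omega
  have hβ0 : 0 ≤ β := by omega
  have hβsq : β ^ 2 ≤ 4 * N + 1 := by
    have : ((d : ℤ)) ^ 2 ≤ 4 * N + 1 := by exact_mod_cast hsqrt
    exact (pow_le_pow_left₀ hβ0 hβd 2).trans this
  have hvβ : (v : ℤ) = β + t := by omega
  have hNvZ : 6 * (N : ℤ) ≤ v * (v + 1) := by exact_mod_cast hNv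
  rw [hvβ] at hNvZ
  -- From `3β² ≤ 12N + 3 ≤ 2v(v+1) + 3` and `v = β + t` follows `(β - 2t - 1)² ≤ 6t² + 6t + 4`,
  -- while `hqZ` says that this square exceeds `8t² + 6t + 4`.
  nlinarith [sq_nonneg t]
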